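/- Let $q\ge 2$ be a fixed integer. An integer matrix $A\in\mathbb{Z}^{m\times n}$ is called an $\mathrm{EQ}_q$ matrix if $Ax=0$ has no non-trivial solution $x\in\{-q+1,\dots,q-1\}^n$. A matrix $M\in\mathbb{Z}^{rm\times n}$ (where $r\ge 1$ is real and $rm$ is an integer) is called $\mathrm{RMDS}_q$ with MDS rate $r$ and EQ rate $n/m$ if every $m\times n$ submatrix of $M$, obtained by selecting $m$ of its rows, is an $\mathrm{EQ}_q$ matrix. Theorem. An $\mathrm{RMDS}_q$ matrix $M\in\mathbb{Z}^{rm\times n}$ with entries in $\{-W,\dots,W\}$ exists if $m=\Omega(n/\log n)$ and $W=O(r)$, for suitable implied constants. Precisely: there are constants $c,K>0$ and $n_0\in\mathbb{N}$, depending only on $q$, such that for all integers $n\ge n_0$, all integers $m\ge c\,n/\log n$ and all real $r\ge 1$ for which $rm$ is an integer, there are an integer $0\le W\le Kr$ and a matrix $M\in\mathbb{Z}^{rm\times n}$ with entries in $\{-W,\dots,W\}$ that is $\mathrm{RMDS}_q$ with MDS rate $r$ and EQ rate $n/m$. In particular $m=\lceil c\,n/\log n\rceil=\Theta(n/\log n)$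 is allowed, so that the EQ rate is $\Theta(\log n)$. -/

import Mathlib

/-- An integer matrix `A` with `m` rows and `n` columns is an `EQ_q` matrix if the homogeneous
system `A x = 0` has no non-trivial solution `x` with entries in `{-q+1, …, q-1}`. -/
def IsEQ (q : ℕ) {m n : ℕ} (A : Matrix (Fin m) (Fin n) ℤ) : Prop :=
  ∀ x : Fin n → ℤ, (∀ j, -(q : ℤ) + 1 ≤ x j ∧ x j ≤ (q : ℤ) - 1) → A.mulVec x = 0 → x = 0

/-- An integer matrix `A` with `N` rows and `n` columns is `RMDS_q` (MDS for `q`-ary bijections)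
with MDS rate `N / m` and EQ rate `n / m` if every `m × n` submatrix of `A`, obtained by
selecting `m` of the `N` rows, is an `EQ_q` matrix. -/
def IsRMDS (q m : ℕ) {N n : ℕ} (A : Matrix (Fin N) (Fin n) ℤ) : Prop :=
  ∀ f : Fin m ↪o Fin N, IsEQ q (A.submatrix f id)

/-!
The matrix is found by the first moment method. It is `RMDS_q` if for every nonzero `x` in the box
`{-q+1, …, q-1}^n` fewer than `m` rows are orthogonal to `x`, so it suffices that random rows have,
in expectation, less than one pair of such an `x` and an `m`-set of rows orthogonal to it.

The entries are independent and uniform in `{0, …, 2L - 1}`, with `L` of order `r` and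
`L ≡ 1` modulo `q!`, and each is written as `b + L ε` with `0 ≤ b < L` and `ε ∈ {0, 1}`. If `x` has
support of size `s ≥ 1`, a row is orthogonal to `x` only if `∑ b_j x_j` is divisible by `L`, which
has probability at most `1 / L` as the nonzero `x_j` are coprime to `L`. Given `b`, the sum
`∑ ε_j x_j` is then prescribed, and the Littlewood–Offord bound, a consequence of Sperner's theorem,
gives a further factor `1 / √(s + 1)` (`card_rows_orthogonal_le`).

There are at most `(e r) ^ m` choices of `m` rows among `r m`, so with `L ≥ 8 r` the vector `x`
contributes at most `(e⁻¹ / √(s + 1)) ^ m`. For `s > √n` this is at most `e ^ (-m) n ^ (-m / 4)`,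
and `m ≥ c n / log n` makes `n ^ (-m / 4) ≤ e ^ (-c n / 4)` outweigh the `(2q - 1) ^ n` vectors. For
`s ≤ √n` the factor `e ^ (-m)` suffices, since there are only `n ^ √n * e ^ (2 q)` such vectors and
`√n log n = o(n / log n)` (`sum_weight_pow_lt_one`).
-/

open Finset

/-! ### Anticoncentration of subset sums -/

/-- The middle binomial coefficient is at most `2 ^ s / √(s + 1)`, in squared integer form. -/
theorem choose_half_sq_mul_succ_le (s : ℕ) : (s.choose (s / 2)) ^ 2 * (s + 1) ≤ 4 ^ s := by
  have even : ∀ k : ℕ, k.centralBinom ^ 2 * (2 * k + 1) ≤ 16 ^ k := by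
    intro k
    induction k with
    | zero => simp
    | succ k ih =>
      have h := Nat.succ_mul_centralBinom_succ k
      have h2 : (k + 1) ^ 2 * ((k + 1).centralBinom ^ 2 * (2 * (k + 1) + 1))
          ≤ (k + 1) ^ 2 * 16 ^ (k + 1) := by
        calc (k + 1) ^ 2 * ((k + 1).centralBinom ^ 2 * (2 * (k + 1) + 1))
            = ((k + 1) * (k + 1).centralBinom) ^ 2 * (2 * k + 3) := by ring
          _ = k.centralBinom ^ 2 * (2 * k + 1) * (4 * ((2 * k + 1) * (2 * k + 3))) := by
            rw [h]; ring
          _ ≤ 16 ^ k * (16 * (k + 1) ^ 2) := Nat.mul_le_mul ih (by nlinarith)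
          _ = (k + 1) ^ 2 * 16 ^ (k + 1) := by ring
      exact Nat.le_of_mul_le_mul_left h2 (by positivity)
  obtain ⟨k, rfl | rfl⟩ := Nat.even_or_odd' s
  · have := even k
    rw [Nat.mul_div_cancel_left k two_pos, pow_mul]
    simpa [Nat.centralBinom] using this
  · have h := even (k + 1)
    have h1 : (k + 1).centralBinom = 2 * (2 * k + 1).choose k := by
      rw [Nat.centralBinom, show 2 * (k + 1) = 2 * k + 1 + 1 by ring, Nat.choose_succ_succ,
        Nat.choose_symm_half]
      ring
    rw [h1] at h
    have h2 : (2 * k + 1) / 2 = k := by omega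
    rw [h2]
    have h3 : (16 : ℕ) ^ (k + 1) = 4 * 4 ^ (2 * k + 1) := by
      rw [show (16 : ℕ) = 4 ^ 2 by norm_num, ← pow_mul, ← pow_succ']
      ring_nf
    rw [h3] at h
    nlinarith [Nat.zero_le (((2 * k + 1).choose k) ^ 2)]

/-- The Littlewood–Offord bound of Erdős. Taking the symmetric difference with the set of negative
weights replaces every `x j` by `|x j|`, up to a constant in the sum; sets with equal sums of
positive weights form an antichain, so Sperner's theorem applies. -/
theorem card_subset_sum_eq_le {α : Type*} [Fintype α] [DecidableEq α] (x : α → ℤ)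
    (hx : ∀ j, x j ≠ 0) (v : ℤ) :
    #{E : Finset α | ∑ j ∈ E, x j = v} ≤
      (Fintype.card α).choose (Fintype.card α / 2) := by
  -- The negative weights, flipped to make all weights positive.
  set P : Finset α := {j | x j < 0} with hP
  have key : ∀ E : Finset α, ∑ j ∈ symmDiff E P, |x j| = ∑ j ∈ E, x j - ∑ j ∈ P, x j := by
    intro E
    have h (A : Finset α) (g : α → ℤ) : ∑ j ∈ A, g j = ∑ j, if j ∈ A then g j else 0 := by
      simp
    rw [h _ (fun j => |x j|), h E, h P, ← sum_sub_distrib]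
    refine sum_congr rfl fun j _ => ?_
    by_cases h1 : j ∈ E <;> by_cases h2 : x j < 0
    · simp [hP, mem_symmDiff, h1, h2]
    · simp [hP, mem_symmDiff, h1, h2, abs_of_nonneg (not_lt.mp h2)]
    · simp [hP, mem_symmDiff, h1, h2, abs_of_neg h2]
    · simp [hP, mem_symmDiff, h1, h2]
  rw [← card_image_of_injective _ (symmDiff_left_injective P)]
  apply IsAntichain.sperner
  intro A hA B hB hne hle
  simp only [coe_image, coe_filter, mem_univ, true_and, Set.mem_image, Set.mem_ofPred_eq] at hA hB
  obtain ⟨E, hE, rfl⟩ := hA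
  obtain ⟨F, hF, rfl⟩ := hB
  have hlt : symmDiff E P ⊂ symmDiff F P := lt_of_le_of_ne hle hne
  obtain ⟨j, hjF, hjE⟩ := exists_of_ssubset hlt
  have := sum_lt_sum_of_subset (f := fun j => |x j|) hlt.subset hjF hjE (abs_pos.mpr (hx j))
    fun i _ _ => abs_nonneg (x i)
  rw [key, key, hE, hF] at this
  exact lt_irrefl _ this

/-- The Littlewood–Offord bound for weights that may vanish: the part of `E` where `x` vanishes is
unconstrained. -/
theorem card_subset_sum_eq_le_support {ι : Type*} [Fintype ι] [DecidableEq ι] (x : ι → ℤ) (v : ℤ) :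
    #{E : Finset ι | ∑ j ∈ E, x j = v} ≤
      (#{j | x j ≠ 0}).choose (#{j | x j ≠ 0} / 2) * 2 ^ #{j | x j = 0} := by
  refine (card_le_mul_card_image (f := fun E : Finset ι => E.filter (x · = 0)) _
    ((#{j | x j ≠ 0}).choose (#{j | x j ≠ 0} / 2)) ?_).trans ?_
  · intro A _
    have := card_subset_sum_eq_le (fun j : {j // x j ≠ 0} => x j) (fun j => j.2) v
    rw [Fintype.card_subtype] at this
    refine le_trans (card_le_card_of_injOn (fun E => E.subtype (x · ≠ 0)) ?_ ?_) this
    · intro E hE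
      simp only [coe_filter, mem_filter, mem_univ, true_and, Set.mem_ofPred_eq] at hE ⊢
      rw [← hE.1, ← sum_filter_ne_zero E,
        ← sum_subtype_eq_sum_filter (f := fun j => x j)]
    · intro E hE F hF h
      simp only [coe_filter, mem_filter, mem_univ, true_and, Set.mem_ofPred_eq] at hE hF
      ext j
      by_cases hj : x j = 0
      · have := congrArg (j ∈ ·) (hE.2.trans hF.2.symm)
        simpa [hj] using this
      · have := congrArg ((⟨j, hj⟩ : {j // x j ≠ 0}) ∈ ·) h
        simpa using this
  · gcongr
    rw [← card_powerset]
    refine card_le_card fun A hA => ?_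
    obtain ⟨E, -, rfl⟩ := mem_image.mp hA
    exact mem_powerset.mpr (filter_subset_filter _ (subset_univ E))

/-- At most a fraction `1 / L` of the vectors of residues is orthogonal to `x` modulo `L`, because
the other coordinates determine the one at `j₀`. -/
theorem card_dvd_sum_mul_le {ι : Type*} [Fintype ι] [DecidableEq ι] (L : ℕ) (x : ι → ℤ) {j₀ : ι}
    (h : IsCoprime (L : ℤ) (x j₀)) :
    #{b : ι → Fin L | (L : ℤ) ∣ ∑ j, (b j : ℤ) * x j} * L ≤ L ^ Fintype.card ι := by
  have hinj : #({b : ι → Fin L | (L : ℤ) ∣ ∑ j, (b j : ℤ) * x j} : Finset _) ≤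
      Fintype.card ({j // j ≠ j₀} → Fin L) := by
    refine card_le_card_of_injOn (t := univ) (fun b j => b j) (by simp) ?_
    intro b hb b' hb' heq
    simp only [coe_filter, mem_univ, true_and, Set.mem_ofPred_eq] at hb hb'
    have hne : ∀ j, j ≠ j₀ → b j = b' j := fun j hj => congrFun heq ⟨j, hj⟩
    have hd := dvd_sub hb hb'
    rw [← sum_sub_distrib, sum_eq_single j₀ (fun j _ hj => by rw [hne j hj, sub_self]) (by simp),
      ← sub_mul] at hd
    have hd := h.dvd_of_dvd_mul_right hd
    have h0 : (b j₀ : ℤ) - b' j₀ = 0 := by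
      refine Int.eq_zero_of_abs_lt_dvd hd ?_
      have := (b j₀).2
      have := (b' j₀).2
      rw [abs_lt]
      constructor <;> omega
    funext j
    by_cases hj : j = j₀
    · subst hj
      apply Fin.ext
      omega
    · exact hne j hj
  rw [Fintype.card_fun, Fintype.card_fin, Fintype.card_subtype_compl,
    Fintype.card_subtype_eq] at hinj
  have : 0 < Fintype.card ι := Fintype.card_pos_iff.mpr ⟨j₀⟩
  calc _ ≤ L ^ (Fintype.card ι - 1) * L := by gcongr
    _ = _ := by rw [← pow_succ]; congr 1; omega

/-! ### Rows orthogonal to a fixed vector -/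

/-- Entry `j` of the row encoded by `ρ = (b, E)`: its value is `b j + L` if `j ∈ E` and `b j`
otherwise. For uniform `ρ` the entries are independent and uniform in `{0, …, 2L - 1}`, the pair
separating the residue modulo `L` from the remaining bit. -/
def rowEntry {n L : ℕ} (ρ : (Fin n → Fin L) × Finset (Fin n)) (j : Fin n) : ℤ :=
  ρ.1 j + if j ∈ ρ.2 then (L : ℤ) else 0

/-- A random row is orthogonal to `x` with probability at most `1 / (L √(s + 1))`, `s` being the
size of the support of `x`. The factor `1 / L` comes from reducing modulo `L`; once the residues
are fixed, the sum of `x` over `E` is prescribed and Littlewood–Offord gives the other factor. -/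
theorem card_rows_orthogonal_le {n L : ℕ} (hL : 0 < L) (x : Fin n → ℤ) {j₀ : Fin n}
    (h : IsCoprime (L : ℤ) (x j₀)) :
    (#{ρ : (Fin n → Fin L) × Finset (Fin n) | ∑ j, rowEntry ρ j * x j = 0} : ℝ) ≤
      1 / (L * √(#{j | x j ≠ 0} + 1)) *
        Fintype.card ((Fin n → Fin L) × Finset (Fin n)) := by
  set s := #{j | x j ≠ 0} with hs
  set Z : Finset ((Fin n → Fin L) × Finset (Fin n)) := {ρ | ∑ j, rowEntry ρ j * x j = 0}
  set B : Finset (Fin n → Fin L) := {b | (L : ℤ) ∣ ∑ j, (b j : ℤ) * x j}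
  have hL' : (L : ℤ) ≠ 0 := by exact_mod_cast hL.ne'
  have hsplit : ∀ ρ ∈ Z, ∑ j, (ρ.1 j : ℤ) * x j + L * ∑ j ∈ ρ.2, x j = 0 := by
    intro ρ hρ
    have h0 : ∑ j, rowEntry ρ j * x j = 0 := by simpa [Z] using hρ
    rw [← h0, mul_sum]
    simp [rowEntry, add_mul, sum_add_distrib, ite_mul]
  have hZ : #Z ≤ s.choose (s / 2) * 2 ^ #{j | x j = 0} * #B := by
    refine (card_le_mul_card_image (f := Prod.fst) Z (s.choose (s / 2) * 2 ^ #{j | x j = 0})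
      ?_).trans ?_
    · intro b hb
      refine le_trans (card_le_card_of_injOn Prod.snd ?_ ?_) (card_subset_sum_eq_le_support x
        (-(∑ j, (b j : ℤ) * x j) / L))
      · intro ρ hρ
        simp only [coe_filter, Set.mem_ofPred_eq, mem_univ, true_and] at hρ ⊢
        have := hsplit ρ hρ.1
        rw [hρ.2] at this
        rw [neg_eq_of_add_eq_zero_right this, Int.mul_ediv_cancel_left _ hL']
      · intro ρ hρ ρ' hρ' he
        simp only [coe_filter, Set.mem_ofPred_eq] at hρ hρ'
        exact Prod.ext (hρ.2.trans hρ'.2.symm) he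
    · gcongr
      intro b hb
      obtain ⟨ρ, hρ, rfl⟩ := mem_image.mp hb
      simp only [B, mem_filter, mem_univ, true_and]
      exact ⟨-∑ j ∈ ρ.2, x j, by linarith [hsplit ρ hρ]⟩
  have hB : #B * L ≤ L ^ n := by simpa using card_dvd_sum_mul_le L x h
  have hC : (s.choose (s / 2) : ℝ) * √(s + 1) ≤ 2 ^ s := by
    refine (sq_le_sq₀ (by positivity) (by positivity)).mp ?_
    rw [mul_pow, Real.sq_sqrt (by positivity), ← pow_mul, mul_comm s, pow_mul]
    norm_num
    exact_mod_cast choose_half_sq_mul_succ_le s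
  have hn : #{j | x j = 0} + s = n := by
    have := card_filter_add_card_filter_not (s := (univ : Finset (Fin n))) (fun j => x j = 0)
    simpa using this
  have hL0 : (0 : ℝ) < L := by exact_mod_cast hL
  have hq : 0 < √((s : ℝ) + 1) := Real.sqrt_pos.mpr (by positivity)
  rw [one_div_mul_eq_div, le_div_iff₀ (by positivity)]
  have hcard : (Fintype.card ((Fin n → Fin L) × Finset (Fin n)) : ℝ) = L ^ n * 2 ^ n := by simp
  rw [hcard]
  calc (#Z : ℝ) * (L * √(s + 1))
      ≤ (s.choose (s / 2) * 2 ^ #{j | x j = 0} * #B) * (L * √(s + 1)) := by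
        gcongr
        exact_mod_cast hZ
    _ = (s.choose (s / 2) * √(s + 1)) * 2 ^ #{j | x j = 0} * (#B * L) := by ring
    _ ≤ 2 ^ s * 2 ^ #{j | x j = 0} * L ^ n := by
        gcongr
        exact_mod_cast hB
    _ = L ^ n * 2 ^ n := by
        rw [← pow_add, add_comm s, hn, mul_comm]

/-! ### The first moment method -/

/-- First moment method for independent uniform rows: if the expected number of pairs of an
`x ∈ X` and an `m`-set of rows all lying in `Z x` is below `1`, some choice of rows has no such
pair. -/
theorem exists_rows_avoiding {R ξ : Type*} [Fintype R] [Nonempty R] [DecidableEq R]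
    {N m : ℕ} (X : Finset ξ) (Z : ξ → Finset R) (p : ξ → ℝ)
    (hp : ∀ x ∈ X, (#(Z x) : ℝ) ≤ p x * Fintype.card R)
    (h : (N.choose m : ℝ) * ∑ x ∈ X, p x ^ m < 1) :
    ∃ M : Fin N → R, ∀ x ∈ X, ∀ T : Finset (Fin N), #T = m → ∃ i ∈ T, M i ∉ Z x := by
  classical
  by_contra! hcon
  -- The row assignments for which all rows in `y.2` lie in `Z y.1`.
  set bad : ξ × Finset (Fin N) → Finset (Fin N → R) := fun y =>
    Fintype.piFinset fun i => if i ∈ y.2 then Z y.1 else univ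
  have hcover : (univ : Finset (Fin N → R)) ⊆ (X ×ˢ powersetCard m univ).biUnion bad := by
    intro M _
    obtain ⟨x, hx, T, hT, hM⟩ := hcon M
    refine mem_biUnion.mpr ⟨(x, T), by simp [hx, hT], ?_⟩
    simp only [bad, Fintype.mem_piFinset]
    intro i
    split_ifs with hi
    · exact hM i hi
    · exact mem_univ _
  have hR : (0 : ℝ) < Fintype.card R := by exact_mod_cast Fintype.card_pos
  have hbad : ∀ y ∈ X ×ˢ powersetCard m (univ : Finset (Fin N)),
      (#(bad y) : ℝ) ≤ p y.1 ^ m * (Fintype.card R : ℝ) ^ N := by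
    rintro ⟨x, T⟩ hy
    simp only [mem_product, mem_powersetCard_univ] at hy
    obtain ⟨hx, rfl⟩ := hy
    have hle : #T ≤ N := by simpa using card_le_univ T
    have hcard : #(bad (x, T)) = #(Z x) ^ #T * Fintype.card R ^ (N - #T) := by
      simp only [bad, Fintype.card_piFinset, apply_ite card]
      rw [prod_ite, prod_const, prod_const]
      simp [filter_not, ← compl_eq_univ_sdiff, card_compl]
    calc (#(bad (x, T)) : ℝ) = (#(Z x) : ℝ) ^ #T * (Fintype.card R : ℝ) ^ (N - #T) := by
          rw [hcard]; push_cast; rfl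
      _ ≤ (p x * Fintype.card R) ^ #T * (Fintype.card R : ℝ) ^ (N - #T) := by
          gcongr
          exact hp x hx
      _ = p x ^ #T * (Fintype.card R : ℝ) ^ N := by
          rw [mul_pow, mul_assoc, ← pow_add, Nat.add_sub_cancel' hle]
  have hcount : (Fintype.card R : ℝ) ^ N ≤
      ((N.choose m : ℝ) * ∑ x ∈ X, p x ^ m) * (Fintype.card R : ℝ) ^ N := by
    calc (Fintype.card R : ℝ) ^ N = #(univ : Finset (Fin N → R)) := by simp
      _ ≤ ∑ y ∈ X ×ˢ powersetCard m univ, (#(bad y) : ℝ) := by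
          exact_mod_cast (card_le_card hcover).trans card_biUnion_le
      _ ≤ ∑ y ∈ X ×ˢ powersetCard m (univ : Finset (Fin N)),
            p y.1 ^ m * (Fintype.card R : ℝ) ^ N := sum_le_sum hbad
      _ = _ := by
          rw [sum_product, mul_sum, sum_mul]
          exact sum_congr rfl fun x _ => by simp [mul_assoc]
  have : (Fintype.card R : ℝ) ^ N < (Fintype.card R : ℝ) ^ N :=
    hcount.trans_lt (mul_lt_of_lt_one_left (by positivity) h)
  exact lt_irrefl _ this

theorem choose_le_mul_exp_pow {N m : ℕ} {r : ℝ} (hr : 0 ≤ r) (hN : (N : ℝ) = r * m) :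
    (N.choose m : ℝ) ≤ (r * Real.exp 1) ^ m := by
  calc (N.choose m : ℝ) ≤ (N : ℝ) ^ m / m.factorial := Nat.choose_le_pow_div m N
    _ = r ^ m * ((m : ℝ) ^ m / m.factorial) := by rw [hN, mul_pow, mul_div_assoc]
    _ ≤ r ^ m * Real.exp m := by
        gcongr
        exact Real.pow_div_factorial_le_exp _ (by positivity) m
    _ = _ := by rw [mul_pow, ← Real.exp_nat_mul, mul_one]

/-! ### Estimating the union bound -/

/-- Generating function of the support size over the box, evaluated at `1 / n`: the sum is a product
over the coordinates, with each factor at most `1 + 2q / n`. -/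
theorem sum_inv_pow_card_support_le (q : ℕ) {n : ℕ} (hn : 0 < n) (hq : 1 ≤ q) :
    ∑ x ∈ Fintype.piFinset fun _ : Fin n => Icc (-(q : ℤ) + 1) (q - 1),
      ((n : ℝ)⁻¹) ^ #{j | x j ≠ 0} ≤ Real.exp (2 * q) := by
  have hterm (x : Fin n → ℤ) : ((n : ℝ)⁻¹) ^ #{j | x j ≠ 0} =
      ∏ j, if x j ≠ 0 then (n : ℝ)⁻¹ else 1 := by
    rw [prod_ite]; simp
  have hn' : (0 : ℝ) < n := by exact_mod_cast hn
  simp_rw [hterm]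
  rw [sum_prod_piFinset (Icc (-(q : ℤ) + 1) (q - 1)) (fun _ a => if a ≠ 0 then (n : ℝ)⁻¹ else 1),
    prod_const, card_univ, Fintype.card_fin]
  have hsum : ∑ a ∈ Icc (-(q : ℤ) + 1) (q - 1), (if a ≠ 0 then (n : ℝ)⁻¹ else 1) ≤
      1 + 2 * q * (n : ℝ)⁻¹ := by
    calc ∑ a ∈ Icc (-(q : ℤ) + 1) (q - 1), (if a ≠ 0 then (n : ℝ)⁻¹ else 1)
        ≤ ∑ a ∈ Icc (-(q : ℤ) + 1) (q - 1), ((if a = 0 then 1 else 0) + (n : ℝ)⁻¹) := by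
          refine sum_le_sum fun a _ => ?_
          by_cases ha : a = 0 <;> simp [ha]
      _ ≤ 1 + 2 * q * (n : ℝ)⁻¹ := by
          rw [sum_add_distrib, sum_const, Int.card_Icc, nsmul_eq_mul]
          gcongr
          · rw [sum_ite_eq']; split_ifs <;> norm_num
          · have : ((q : ℤ) - 1 + 1 - (-(q : ℤ) + 1)).toNat ≤ 2 * q := by omega
            exact_mod_cast this
  calc _ ≤ (1 + 2 * q * (n : ℝ)⁻¹) ^ n := by
        gcongr
    _ ≤ Real.exp (2 * q * (n : ℝ)⁻¹) ^ n := by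
        gcongr
        linarith [Real.add_one_le_exp (2 * q * (n : ℝ)⁻¹)]
    _ = Real.exp (2 * q) := by
        rw [← Real.exp_nat_mul]
        congr 1
        field_simp

theorem eventually_sqrt_mul_log_add_le (C : ℝ) :
    ∀ᶠ n : ℕ in Filter.atTop, √n * Real.log n + C ≤ n / Real.log n := by
  -- The claim after multiplication by `log n`, with `√y * √y = y` absorbing `log y ^ 2 = o(√y)`.
  have h1 : (fun y : ℝ => √y * Real.log y ^ 2 + C * Real.log y) =o[Filter.atTop] (id : ℝ → ℝ) := by
    refine .add ?_ ?_
    · have h2 : (fun y : ℝ => (Real.log y) ^ 2) =o[Filter.atTop] fun y : ℝ => √y := by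
        simpa [Real.sqrt_eq_rpow] using isLittleO_log_rpow_rpow_atTop 2 (s := 1 / 2) (by norm_num)
      refine ((Asymptotics.isBigO_refl (fun y : ℝ => √y) _).mul_isLittleO h2).congr' .rfl ?_
      filter_upwards [Filter.eventually_ge_atTop 0] with y hy using Real.mul_self_sqrt hy
    · exact Real.isLittleO_log_id_atTop.const_mul_left C
  have h2 := tendsto_natCast_atTop_atTop.eventually (h1.bound one_pos)
  filter_upwards [h2, Filter.eventually_ge_atTop 2] with n hn h2
  have hlog : 0 < Real.log n := Real.log_pos (by exact_mod_cast h2)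
  rw [le_div_iff₀ hlog]
  have := (le_abs_self _).trans hn
  simp only [id, one_mul, Real.norm_natCast] at this
  linarith

/-- The contribution of one vector of support size `s` to the union bound. The first summand covers
`s ≤ √n`, where `n ^ (√n - s) ≥ 1`; the second covers `s > √n`, where
`√(s + 1) ≥ n ^ (1 / 4)` and `m * log n ≥ c * n`. -/
theorem weight_pow_le {n m s : ℕ} {c : ℝ} (hn : 2 ≤ n) (hm : c * ((n : ℝ) / Real.log n) ≤ m) :
    (Real.exp (-1) / √(s + 1)) ^ m ≤
      Real.exp (-m) * (Real.exp (√n * Real.log n) * ((n : ℝ)⁻¹) ^ s + Real.exp (-(c * n / 4))) := by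
  have hn0 : (0 : ℝ) < n := by positivity
  have hlog : 0 < Real.log n := Real.log_pos (by exact_mod_cast hn)
  have hs0 : (0 : ℝ) ≤ s := s.cast_nonneg
  rw [div_eq_mul_inv, mul_pow, ← Real.exp_nat_mul, mul_neg_one]
  gcongr
  rcases le_or_gt (s : ℝ) (√n) with hs | hs
  · have h1 : (√((s : ℝ) + 1))⁻¹ ^ m ≤ 1 :=
      pow_le_one₀ (by positivity) (inv_le_one_of_one_le₀ (Real.one_le_sqrt.mpr (by linarith)))
    have h2 : Real.exp (√n * Real.log n) * ((n : ℝ)⁻¹) ^ s =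
        Real.exp ((√n - s) * Real.log n) := by
      rw [← Real.exp_log hn0, ← Real.exp_neg, ← Real.exp_nat_mul, ← Real.exp_add, Real.exp_log hn0]
      ring_nf
    have h3 : 1 ≤ Real.exp ((√n - s) * Real.log n) :=
      Real.one_le_exp (mul_nonneg (by linarith) hlog.le)
    rw [h2]
    linarith [Real.exp_pos (-(c * n / 4))]
  · have h1 : Real.exp (Real.log n / 4) ≤ √(s + 1) := by
      have : Real.log n / 4 = Real.log (√(√n)) := by
        rw [Real.log_sqrt (by positivity), Real.log_sqrt hn0.le]; ring
      rw [this, Real.exp_log (by positivity)]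
      exact Real.sqrt_le_sqrt (by linarith)
    have h2 : c * n ≤ m * Real.log n := by
      rwa [← mul_div_assoc, div_le_iff₀ hlog] at hm
    calc (√((s : ℝ) + 1))⁻¹ ^ m ≤ (Real.exp (Real.log n / 4))⁻¹ ^ m := by gcongr
      _ = Real.exp (-(m * Real.log n / 4)) := by
        rw [← Real.exp_neg, ← Real.exp_nat_mul]; ring_nf
      _ ≤ Real.exp (-(c * n / 4)) := by gcongr
      _ ≤ _ := le_add_of_nonneg_left (by positivity)

theorem sum_weight_pow_lt_one {q n m : ℕ} {c : ℝ} (hq : 1 ≤ q) (hn : 2 ≤ n)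
    (hc : 4 * Real.log (2 * q) ≤ c) (hm : c * ((n : ℝ) / Real.log n) ≤ m)
    (hm' : √n * Real.log n + (2 * q + 1) ≤ m) :
    ∑ x ∈ Fintype.piFinset fun _ : Fin n => Icc (-(q : ℤ) + 1) (q - 1),
      (Real.exp (-1) / √(#{j | x j ≠ 0} + 1)) ^ m < 1 := by
  set V := Icc (-(q : ℤ) + 1) (q - 1)
  have hV : (#V : ℝ) ≤ 2 * q := by
    have : #V ≤ 2 * q := by rw [Int.card_Icc]; omega
    exact_mod_cast this
  have hq0 : (0 : ℝ) < 2 * q := by positivity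
  have hlarge : (#V : ℝ) ^ n * Real.exp (-(c * n / 4)) ≤ 1 := by
    calc (#V : ℝ) ^ n * Real.exp (-(c * n / 4))
        ≤ (2 * q : ℝ) ^ n * Real.exp (-(c * n / 4)) := by gcongr
      _ = Real.exp (n * Real.log (2 * q) - c * n / 4) := by
        rw [sub_eq_add_neg, Real.exp_add, Real.exp_nat_mul, Real.exp_log hq0]
      _ ≤ 1 := Real.exp_le_one_iff.mpr (by
        nlinarith [mul_le_mul_of_nonneg_right hc (n.cast_nonneg : (0 : ℝ) ≤ n)])
  have hsmall : Real.exp (√n * Real.log n) * Real.exp (2 * q) ≤ Real.exp (m - 1) := by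
    rw [← Real.exp_add]
    gcongr
    linarith
  have hm1 : (1 : ℝ) ≤ m := by
    have : 0 ≤ √(n : ℝ) * Real.log n := by positivity
    linarith
  calc _ ≤ ∑ x ∈ Fintype.piFinset fun _ : Fin n => V, Real.exp (-m) *
        (Real.exp (√n * Real.log n) * ((n : ℝ)⁻¹) ^ #{j | x j ≠ 0} + Real.exp (-(c * n / 4))) :=
        sum_le_sum fun x _ => weight_pow_le hn hm
    _ = Real.exp (-m) * (Real.exp (√n * Real.log n) *
        (∑ x ∈ Fintype.piFinset fun _ : Fin n => V, ((n : ℝ)⁻¹) ^ #{j | x j ≠ 0}) +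
          (#V : ℝ) ^ n * Real.exp (-(c * n / 4))) := by
        rw [← mul_sum, sum_add_distrib, ← mul_sum]
        simp
    _ ≤ Real.exp (-m) * (Real.exp (√n * Real.log n) * Real.exp (2 * q) + 1) := by
        gcongr
        exact sum_inv_pow_card_support_le q (by omega) hq
    _ ≤ Real.exp (-m) * (Real.exp (m - 1) + 1) := by gcongr
    _ = Real.exp (-1) + Real.exp (-m) := by
        rw [mul_add, ← Real.exp_add]; ring_nf
    _ ≤ Real.exp (-1) + Real.exp (-1) := by gcongr
    _ < 1 := by
        rw [Real.exp_neg, ← two_mul, ← div_eq_mul_inv, div_lt_one (Real.exp_pos 1)]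
        linarith [Real.exp_one_gt_d9]

/-! ### Existence of the matrix -/

theorem isCoprime_factorial_mul_add_one {q : ℕ} (t : ℕ) {a : ℤ} (ha : a ≠ 0) (haq : a.natAbs ≤ q) :
    IsCoprime ((q.factorial * t + 1 : ℕ) : ℤ) a := by
  have hdvd : a ∣ (q.factorial : ℤ) :=
    Int.natAbs_dvd.mp (by exact_mod_cast Nat.dvd_factorial (Int.natAbs_pos.mpr ha) haq)
  obtain ⟨k, hk⟩ := hdvd
  exact ⟨1, -(k * t), by push_cast; rw [hk]; ring⟩

/-- Choosing `m` of `N = r m` rows costs a factor at most `(e r) ^ m`, which `L ≥ 8 r ≥ e² r`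
turns into a gain of `e⁻¹` per row. -/
theorem choose_mul_inv_pow_le {N m : ℕ} {r L y : ℝ} (hr : 1 ≤ r) (hL : 8 * r ≤ L) (hy : 0 ≤ y)
    (hN : (N : ℝ) = r * m) :
    (N.choose m : ℝ) * (1 / (L * y)) ^ m ≤ (Real.exp (-1) / y) ^ m := by
  have hL0 : 0 < L := by linarith
  have hre : r * Real.exp 1 / L ≤ Real.exp (-1) := by
    have h8 : Real.exp 1 * Real.exp 1 ≤ 8 := by
      nlinarith [Real.exp_one_lt_d9, Real.exp_pos 1]
    rw [div_le_iff₀ hL0, Real.exp_neg, inv_mul_eq_div, le_div_iff₀ (Real.exp_pos 1)]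
    nlinarith
  calc (N.choose m : ℝ) * (1 / (L * y)) ^ m
      ≤ (r * Real.exp 1) ^ m * (1 / (L * y)) ^ m := by
        gcongr
        exact choose_le_mul_exp_pow (by linarith) hN
    _ = (r * Real.exp 1 / L / y) ^ m := by
        rw [← mul_pow, mul_one_div, div_div]
    _ ≤ (Real.exp (-1) / y) ^ m := by gcongr

theorem exists_isRMDS {q n m N L : ℕ} {r : ℝ} (hL : 8 * r ≤ L) (hr : 1 ≤ r) (hN : (N : ℝ) = r * m)
    (hcop : ∀ a : ℤ, a ≠ 0 → a.natAbs ≤ q → IsCoprime (L : ℤ) a)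
    (hsum : ∑ x ∈ Fintype.piFinset fun _ : Fin n => Icc (-(q : ℤ) + 1) (q - 1),
      (Real.exp (-1) / √(#{j | x j ≠ 0} + 1)) ^ m < 1) :
    ∃ M : Matrix (Fin N) (Fin n) ℤ, (∀ i j, 0 ≤ M i j ∧ M i j ≤ 2 * L) ∧ IsRMDS q m M := by
  set V := Icc (-(q : ℤ) + 1) (q - 1)
  have hL0 : (0 : ℝ) < L := by linarith
  have hLpos : 0 < L := by exact_mod_cast hL0
  have : NeZero L := ⟨hLpos.ne'⟩
  have hp : ∀ x ∈ (Fintype.piFinset fun _ : Fin n => V).filter (· ≠ 0),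
      (#({ρ : (Fin n → Fin L) × Finset (Fin n) | ∑ j, rowEntry ρ j * x j = 0} : Finset _) : ℝ) ≤
        1 / (L * √(#{j | x j ≠ 0} + 1)) *
          Fintype.card ((Fin n → Fin L) × Finset (Fin n)) := by
    intro x hx
    rw [mem_filter, Fintype.mem_piFinset] at hx
    obtain ⟨j₀, hj₀⟩ := Function.ne_iff.mp hx.2
    refine card_rows_orthogonal_le hLpos x (hcop (x j₀) hj₀ ?_)
    have := mem_Icc.mp (hx.1 j₀)
    omega
  obtain ⟨M, hM⟩ := exists_rows_avoiding (N := N) (m := m) _ _ _ hp (by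
    refine lt_of_le_of_lt ?_ hsum
    rw [mul_sum]
    refine (sum_le_sum fun x _ => choose_mul_inv_pow_le hr hL (Real.sqrt_nonneg _) hN).trans ?_
    exact sum_le_sum_of_subset_of_nonneg (filter_subset _ _)
      fun x _ _ => pow_nonneg (div_nonneg (Real.exp_pos _).le (Real.sqrt_nonneg _)) _)
  refine ⟨fun i j => rowEntry (M i) j, fun i j => ?_, fun f x hx hmul => ?_⟩
  · have := ((M i).1 j).2
    simp only [rowEntry]
    split_ifs <;> constructor <;> omega
  · by_contra hne
    obtain ⟨i, hi, hMi⟩ := hM x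
      (mem_filter.mpr ⟨Fintype.mem_piFinset.mpr fun j => mem_Icc.mpr (hx j), hne⟩)
      (univ.map f.toEmbedding) (by simp)
    obtain ⟨k, -, rfl⟩ := mem_map.mp hi
    refine hMi (mem_filter.mpr ⟨mem_univ _, ?_⟩)
    exact congrFun hmul k

theorem theorem4 (q : ℕ) (hq : 2 ≤ q) :
    ∃ c K : ℝ, 0 < c ∧ 0 < K ∧ ∃ n₀ : ℕ, ∀ n : ℕ, n₀ ≤ n →
      ∀ m : ℕ, c * ((n : ℝ) / Real.log n) ≤ (m : ℝ) →
        ∀ r : ℝ, 1 ≤ r → ∀ N : ℕ, (N : ℝ) = r * m →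
          ∃ W : ℕ, (W : ℝ) ≤ K * r ∧
            ∃ M : Matrix (Fin N) (Fin n) ℤ,
              (∀ i j, -(W : ℤ) ≤ M i j ∧ M i j ≤ (W : ℤ)) ∧ IsRMDS q m M := by
  have hlog : 0 ≤ Real.log (2 * q) :=
    Real.log_nonneg (by have : (2 : ℝ) ≤ q := by exact_mod_cast hq
                        linarith)
  obtain ⟨n₀, hn₀⟩ := Filter.eventually_atTop.mp (eventually_sqrt_mul_log_add_le (2 * q + 1))
  refine ⟨4 * Real.log (2 * q) + 1, 20 * q.factorial, by positivity, by positivity, max n₀ 2, ?_⟩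
  intro n hn m hm r hr N hN
  have hn2 : 2 ≤ n := (le_max_right _ _).trans hn
  have hm' : √n * Real.log n + (2 * q + 1) ≤ m := by
    have h1 := hn₀ n ((le_max_left _ _).trans hn)
    have h2 : 0 ≤ (n : ℝ) / Real.log n := by positivity
    nlinarith
  -- `L = q! * t + 1` is coprime to every nonzero entry of a candidate solution.
  set t := ⌈8 * r⌉₊
  have ht : 8 * r ≤ t := Nat.le_ceil _
  have ht' : (t : ℝ) < 8 * r + 1 := Nat.ceil_lt_add_one (by positivity)
  have hfac : (1 : ℝ) ≤ q.factorial := by exact_mod_cast q.factorial_pos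
  obtain ⟨M, hM, hRMDS⟩ := exists_isRMDS (q := q) (n := n) (L := q.factorial * t + 1)
    (by push_cast; nlinarith) hr hN
    (fun a => isCoprime_factorial_mul_add_one t)
    (sum_weight_pow_lt_one (by omega) hn2 (by linarith) hm hm')
  refine ⟨2 * (q.factorial * t + 1), ?_, M, fun i j => ?_, hRMDS⟩
  · push_cast
    nlinarith
  · have := hM i j
    push_cast at this ⊢
    constructor <;> omega
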